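/- Let $R$ be an ordered field and let $\mathfrak R=(R,0,1,+,\cdot,<,\dots)$ be an expansion of $R$ (a first-order structure on $R$ whose language contains symbols for $0,1,+,\cdot,<$ and possibly further ones) that is definably complete: every non-empty subset of $R$ that is definable in $\mathfrak R$ and bounded from above has a least upper bound in $R$. (Such an $R$ is automatically real closed.) "Definable" means definable in $\mathfrak R$, possibly with parameters. Let $n\ge 0$, and write $\langle x,y\rangle=\sum_{i=1}^n x_iy_i$ and $\|x\|^2=\langle x,x\rangle$ on $R^n$. A set-valued map $T\colon R^n\rightrightarrows R^n$ assigns to each $x\in R^n$ a subset $T(x)\subseteq R^n$; its graph is $\{(x,x^*)\in R^n\times R^n : x^*\in T(x)\}$, and $T$ is called definable if its graph is definable. A map $g\colon X\to R^n$ with $X\subseteq R^n$ is identified with the set-valued map having the same graph. The sum of two set-valued maps is $(S+T)(x)=\{a+b: a\in S(x),\ b\in T(x)\}$, and the inverse of $T$ is $T^{-1}(x^*)=\{x : x^*\in T(x)\}$. A pair $(x,x^*)\in R^n\times R^n$ is monotonically related to $T$ if $\langle x-y,x^*-y^*\rangle\ge 0$ for all $(y,y^*)$ in the graph of $T$. The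 map $T$ is monotone if every pair in its graph is monotonically related to $T$, and maximal monotone if it is monotone and no pair outside its graph is monotonically related to $T$. A map $g\colon X\to R^n$, where $X\subseteq R^n$, is firmly non-expansive if $\|g(x)-g(y)\|^2\le\langle g(x)-g(y),x-y\rangle$ for all $x,y\in X$. **Proposition.** Let $T\colon R^n\rightrightarrows R^n$ be a set-valued map and let $f=(T+\operatorname{id})^{-1}$. Then: 1. $T$ is monotone if and only if $f$ is a firmly non-expansive map $X\to R^n$ for some $X\subseteq R^n$; 2. if $f$ is a firmly non-expansive map $R^n\to R^n$ (defined on all of $R^n$), then $T$ is maximal monotone; 3. if $T$ is definable and maximal monotone, then $f$ is a firmly non-expansive map $R^n\to R^n$ (defined on all of $R^n$). -/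

import Mathlib

namespace DefinableMonotone

open scoped Pointwise

universe u v w

section ModelTheory

variable (L : FirstOrder.Language.{u, v}) (R : Type w) [L.Structure R]

/-- The `L`-structure `R` is an expansion `(R, 0, 1, +, ·, <, …)` of the ordered field `R`:
among the symbols of `L` there are ones that name `0`, `1`, addition, multiplication and the
strict order of `R`. Nothing is said about the other symbols. -/
structure IsOrderedFieldExpansion [Field R] [LinearOrder R] : Prop where
  exists_zero : ∃ c : L.Functions 0,
    FirstOrder.Language.Structure.funMap c (![] : Fin 0 → R) = 0
  exists_one : ∃ c : L.Functions 0,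
    FirstOrder.Language.Structure.funMap c (![] : Fin 0 → R) = 1
  exists_add : ∃ g : L.Functions 2,
    ∀ x y : R, FirstOrder.Language.Structure.funMap g ![x, y] = x + y
  exists_mul : ∃ g : L.Functions 2,
    ∀ x y : R, FirstOrder.Language.Structure.funMap g ![x, y] = x * y
  exists_lt : ∃ r : L.Relations 2,
    ∀ x y : R, FirstOrder.Language.Structure.RelMap r ![x, y] ↔ x < y

/-- Definable completeness: every non-empty subset of `R` that is definable (with parameters from
`R`) and bounded from above has a least upper bound in `R`. -/
def IsDefinablyComplete [LinearOrder R] : Prop :=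
  ∀ S : Set R, (Set.univ : Set R).Definable₁ L S → S.Nonempty → BddAbove S → ∃ a, IsLUB S a

end ModelTheory

/-- A set-valued map `R^m ⇉ R^n`. -/
abbrev SetValuedMap (R : Type w) (m n : ℕ) : Type w := (Fin m → R) → Set (Fin n → R)

namespace SetValuedMap

variable {R : Type w} {m n : ℕ}

/-- The graph `{(x, x*) : x* ∈ T x}` of a set-valued map. -/
def graph (T : SetValuedMap R m n) : Set ((Fin m → R) × (Fin n → R)) :=
  {p | p.2 ∈ T p.1}

/-- The inverse of a set-valued map: `x ∈ T⁻¹ x*` if and only if `x* ∈ T x`. -/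
def inverse (T : SetValuedMap R m n) : SetValuedMap R n m :=
  fun y => {x | y ∈ T x}

/-- The sum of set-valued maps: `(S + T) x` is the Minkowski sum of `S x` and `T x`. -/
def sum [Add R] (S T : SetValuedMap R m n) : SetValuedMap R m n :=
  fun x => S x + T x

/-- The set-valued map `R^m ⇉ R^n` associated with a map `g : X → R^n`, where `X ⊆ R^m`. -/
def ofMap {X : Set (Fin m → R)} (g : X → Fin n → R) : SetValuedMap R m n :=
  fun x => {y | ∃ hx : x ∈ X, y = g ⟨x, hx⟩}

/-- The identity map of `R^n`, as a set-valued map. -/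
def identity : SetValuedMap R n n :=
  fun x => {x}

/-- A set-valued map `R^m ⇉ R^n` is definable if its graph is a definable (with parameters from
`R`) subset of `R^m × R^n`, that is, if it comes from a definable family of subsets of `R^n`. -/
def IsDefinable (L : FirstOrder.Language.{u, v}) [L.Structure R] (T : SetValuedMap R m n) : Prop :=
  (Set.univ : Set R).Definable L
    {z : Fin m ⊕ Fin n → R | (z ∘ Sum.inl, z ∘ Sum.inr) ∈ T.graph}

section Monotone

variable [Field R] [LinearOrder R]

/-- `p = (x, x*)` is monotonically related to `T` if `⟨x - y, x* - y*⟩ ≥ 0` for all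
`(y, y*)` in the graph of `T`. -/
def MonotonicallyRelated (T : SetValuedMap R n n) (p : (Fin n → R) × (Fin n → R)) : Prop :=
  ∀ q ∈ T.graph, 0 ≤ (p.1 - q.1) ⬝ᵥ (p.2 - q.2)

/-- `T` is monotone if every element of its graph is monotonically related to `T`. -/
def IsMonotone (T : SetValuedMap R n n) : Prop :=
  ∀ p ∈ T.graph, T.MonotonicallyRelated p

/-- `T` is maximal monotone if it is monotone and no pair outside its graph is monotonically
related to `T`. -/
def IsMaximalMonotone (T : SetValuedMap R n n) : Prop :=
  T.IsMonotone ∧ ∀ p, p ∉ T.graph → ¬ T.MonotonicallyRelated p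

end Monotone

end SetValuedMap

section FirmlyNonexpansive

variable {R : Type w} [Field R] [LinearOrder R] {n : ℕ}

/-- A map `g : X → R^n`, where `X ⊆ R^n`, is firmly non-expansive if
`‖g x - g y‖² ≤ ⟨g x - g y, x - y⟩` for all `x, y ∈ X`; here `‖v‖² = ⟨v, v⟩`. -/
def FirmlyNonexpansive {X : Set (Fin n → R)} (g : X → Fin n → R) : Prop :=
  ∀ x y : X, (g x - g y) ⬝ᵥ (g x - g y) ≤ (g x - g y) ⬝ᵥ ((x : Fin n → R) - y)

/-- The set-valued map `f` is (the set-valued map associated with) a firmly non-expansive map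
`X → R^n`. -/
def SetValuedMap.IsFirmlyNonexpansiveMapOn (f : SetValuedMap R n n) (X : Set (Fin n → R)) :
    Prop :=
  ∃ g : X → Fin n → R, FirmlyNonexpansive g ∧ f = SetValuedMap.ofMap g

end FirmlyNonexpansive

end DefinableMonotone

/-!
The pair `(x, w)` lies in the graph of `f = (T + id)⁻¹` if and only if `(w, x - w)` lies in the
graph of `T`, and `‖w - w'‖² ≤ ⟨w - w', x - x'⟩` says that
`⟨w - w', (x - w) - (x' - w')⟩ ≥ 0`. So monotonicity of `T` is the firm non-expansiveness of `f`;
single-valuedness of `f` is the case `x = x'`. If `f` is defined at `x + u`, where `(x, u)` is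
monotonically related to `T`, then `w = f (x + u)` satisfies `-‖x - w‖² ≥ 0`, whence `x = w` and
`(x, u)` is in the graph: this gives maximality.

The remaining claim is that `T + id` is surjective for definable maximal monotone `T`. After a
translation it is enough to find `w` with `-w ∈ T w`. Compactness is not available over `R`, and
definable completeness does not give the finite intersection property for definable families.
Instead one minimizes a strongly convex function. With the Fitzpatrick function
`F (x, u) = sup {⟨x, y*⟩ + ⟨y, u⟩ - ⟨y, y*⟩ : y* ∈ T y}` of `T`, put `H p = 2 F p + ‖p‖²` on
`R^n × R^n`. Three facts are needed.

* `H` attains its minimum `m` at some `a` (`exists_isUpperValue_minimal`). The infimum `m` of the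
  values exists by definable completeness. By strong convexity, points at which `H` is at most
  `m + δ² / 2` and `m + δ'² / 2` are at distance at most `δ + δ'`; hence each coordinate of the
  minimizer is the supremum of a definable set, and no induction on the dimension is needed.
* `F (x, u) ≥ ⟨x, u⟩`, by maximality (`SetValuedMap.IsMaximalMonotone.le_of_isUpperValue`).
* Optimality at `a` bounds `⟨y, y*⟩` from below on the graph of `T`
  (`SetValuedMap.IsMonotone.le_of_minimal`).

Together they give `⟨-a₂ - y, -a₁ - y*⟩ ≥ ‖a₁ + a₂‖²` for `a = (a₁, a₂)` and all `(y, y*)` in the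
graph of `T`. So `(-a₂, -a₁)` is in the graph, and inserting it for `(y, y*)` gives `a₁ = -a₂`, that
is, `-w ∈ T w` for `w = -a₂`.
-/

namespace DefinableMonotone

/-! ### Definable functions in expansions of ordered fields -/

section Definability

theorem definableFun_const {R : Type*} {L : FirstOrder.Language} [L.Structure R] {α : Type*}
    (c : R) : (Set.univ : Set R).DefinableFun L (fun _ : α → R => c) :=
  L.definableFun_const α (Set.mem_univ c)

variable {R : Type*} [Field R] [LinearOrder R] {L : FirstOrder.Language} [L.Structure R]
  {α : Type*}

theorem IsOrderedFieldExpansion.definableFun_add (h : IsOrderedFieldExpansion L R)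
    {f g : (α → R) → R} (hf : (Set.univ : Set R).DefinableFun L f)
    (hg : (Set.univ : Set R).DefinableFun L g) :
    (Set.univ : Set R).DefinableFun L (fun v => f v + g v) := by
  obtain ⟨a, ha⟩ := h.exists_add
  have hF : (Set.univ : Set R).DefinableMap L (fun v => ![f v, g v]) := by
    simp [Set.DefinableMap, *]
  simpa only [ha] using Set.DefinableFun.comp hF (.of_empty (.fun_symbol a))

theorem IsOrderedFieldExpansion.definableFun_mul (h : IsOrderedFieldExpansion L R)
    {f g : (α → R) → R} (hf : (Set.univ : Set R).DefinableFun L f)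
    (hg : (Set.univ : Set R).DefinableFun L g) :
    (Set.univ : Set R).DefinableFun L (fun v => f v * g v) := by
  obtain ⟨a, ha⟩ := h.exists_mul
  have hF : (Set.univ : Set R).DefinableMap L (fun v => ![f v, g v]) := by
    simp [Set.DefinableMap, *]
  simpa only [ha] using Set.DefinableFun.comp hF (.of_empty (.fun_symbol a))

theorem IsOrderedFieldExpansion.definableFun_neg (h : IsOrderedFieldExpansion L R)
    {f : (α → R) → R} (hf : (Set.univ : Set R).DefinableFun L f) :
    (Set.univ : Set R).DefinableFun L (fun v => -f v) := by
  simpa only [neg_one_mul] using h.definableFun_mul (definableFun_const (-1)) hf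

theorem IsOrderedFieldExpansion.definableFun_sub (h : IsOrderedFieldExpansion L R)
    {f g : (α → R) → R} (hf : (Set.univ : Set R).DefinableFun L f)
    (hg : (Set.univ : Set R).DefinableFun L g) :
    (Set.univ : Set R).DefinableFun L (fun v => f v - g v) := by
  simpa only [sub_eq_add_neg] using h.definableFun_add hf (h.definableFun_neg hg)

theorem IsOrderedFieldExpansion.definableFun_sum (h : IsOrderedFieldExpansion L R)
    {ι : Type*} (s : Finset ι) {f : ι → (α → R) → R}
    (hf : ∀ i, (Set.univ : Set R).DefinableFun L (f i)) :
    (Set.univ : Set R).DefinableFun L (fun v => ∑ i ∈ s, f i v) := by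
  classical
  induction s using Finset.induction_on with
  | empty => simpa only [Finset.sum_empty] using definableFun_const 0
  | insert i s hi ih => simpa only [Finset.sum_insert hi] using h.definableFun_add (hf i) ih

theorem IsOrderedFieldExpansion.definableFun_dotProduct (h : IsOrderedFieldExpansion L R)
    {ι : Type*} [Fintype ι] {f g : (α → R) → ι → R}
    (hf : (Set.univ : Set R).DefinableMap L f) (hg : (Set.univ : Set R).DefinableMap L g) :
    (Set.univ : Set R).DefinableFun L (fun v => f v ⬝ᵥ g v) :=
  h.definableFun_sum Finset.univ fun i => h.definableFun_mul (hf i) (hg i)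

theorem IsOrderedFieldExpansion.definable_le (h : IsOrderedFieldExpansion L R)
    {f g : (α → R) → R} (hf : (Set.univ : Set R).DefinableFun L f)
    (hg : (Set.univ : Set R).DefinableFun L g) :
    (Set.univ : Set R).Definable L {v | f v ≤ g v} := by
  obtain ⟨r, hr⟩ := h.exists_lt
  have hlt : (∅ : Set R).Definable L {x : Fin 2 → R | x 0 < x 1} := by
    refine Set.empty_definable_iff.2
      ⟨r.formula₂ (FirstOrder.Language.Term.var 0) (FirstOrder.Language.Term.var 1), ?_⟩
    ext x
    simp [FirstOrder.Language.Formula.realize_rel₂, hr]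
  have hF : (Set.univ : Set R).DefinableMap L (fun v => ![g v, f v]) := by
    simp [Set.DefinableMap, *]
  convert ((hlt.mono (Set.empty_subset _)).preimage_map hF).compl using 1
  ext v
  simp

theorem IsDefinablyComplete.exists_isGLB [IsStrictOrderedRing R]
    (hdc : IsDefinablyComplete L R) (h : IsOrderedFieldExpansion L R) {S : Set R}
    (hS : (Set.univ : Set R).Definable₁ L S) (hne : S.Nonempty) (hb : BddBelow S) :
    ∃ a, IsGLB S a := by
  have hneg : (Set.univ : Set R).Definable₁ L (-S) := by
    have hF : (Set.univ : Set R).DefinableMap L (fun (v : Fin 1 → R) (_ : Fin 1) => -v 0) :=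
      fun _ => h.definableFun_neg (Set.DefinableFun.proj L)
    exact hS.preimage_map hF
  obtain ⟨a, ha⟩ := hdc (-S) hneg hne.neg hb.neg
  exact ⟨-a, by simpa using ha.neg⟩

end Definability

/-! ### Minimization of strongly convex functions -/

section Minimization

variable {R : Type*} [Field R] [LinearOrder R] {ι : Type*} [Fintype ι]

/-- `IsUpperValue Q p s` says that `⟨p, p⟩ + sup_{(l, c) ∈ Q} (⟨l, p⟩ + c) ≤ s`. The supremum of
this family of affine functions is only used through its epigraph, so it need not exist in `R`. -/
def IsUpperValue (Q : Set ((ι → R) × R)) (p : ι → R) (s : R) : Prop :=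
  ∀ q ∈ Q, q.1 ⬝ᵥ p + q.2 + p ⬝ᵥ p ≤ s

theorem IsUpperValue.mono {Q : Set ((ι → R) × R)} {p : ι → R} {s t : R}
    (h : IsUpperValue Q p s) (hst : s ≤ t) : IsUpperValue Q p t :=
  fun q hq => (h q hq).trans hst

variable [IsStrictOrderedRing R]

theorem sq_apply_le_dotProduct_self (v : ι → R) (i : ι) : v i ^ 2 ≤ v ⬝ᵥ v := by
  rw [sq]
  exact Finset.single_le_sum (f := fun j => v j * v j) (fun j _ => mul_self_nonneg _)
    (Finset.mem_univ i)

/-- A form of `dotProduct_self_star_nonneg` without a star structure on `R`. -/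
theorem zero_le_dotProduct_self (v : ι → R) : 0 ≤ v ⬝ᵥ v :=
  Finset.sum_nonneg fun _ _ => mul_self_nonneg _

theorem eq_zero_of_dotProduct_self_le_zero {v : ι → R} (h : v ⬝ᵥ v ≤ 0) : v = 0 :=
  dotProduct_self_eq_zero.1 (h.antisymm (zero_le_dotProduct_self v))

/-- Strong convexity along a segment. -/
theorem IsUpperValue.segment {Q : Set ((ι → R) × R)} {p p' : ι → R} {s s' : R}
    (h : IsUpperValue Q p s) (h' : IsUpperValue Q p' s') {t : R} (ht : 0 ≤ t) (ht' : t ≤ 1) :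
    IsUpperValue Q ((1 - t) • p + t • p')
      ((1 - t) * s + t * s' - t * (1 - t) * ((p - p') ⬝ᵥ (p - p'))) := by
  intro q hq
  have h1 := mul_le_mul_of_nonneg_left (h q hq) (sub_nonneg.2 ht')
  have h2 := mul_le_mul_of_nonneg_left (h' q hq) ht
  have h3 : p' ⬝ᵥ p = p ⬝ᵥ p' := dotProduct_comm _ _
  simp only [dotProduct_add, add_dotProduct, dotProduct_sub, sub_dotProduct, dotProduct_smul,
    smul_dotProduct, smul_eq_mul, h3] at h1 h2 ⊢
  linear_combination h1 + h2

/-- Two points whose values are close to the lower bound `m` are close to each other. -/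
theorem IsUpperValue.dotProduct_sub_self_le {Q : Set ((ι → R) × R)} {p p' : ι → R} {s s' m : R}
    (hm : ∀ p s, IsUpperValue Q p s → m ≤ s)
    (h : IsUpperValue Q p s) (h' : IsUpperValue Q p' s') :
    (p - p') ⬝ᵥ (p - p') ≤ 2 * (s - m) + 2 * (s' - m) := by
  have := hm _ _ (h.segment h' (t := 1 / 2) (by norm_num) (by norm_num))
  linarith

/-- A value that is approached at points tending to `a` coordinatewise is an upper value at `a`. -/
theorem isUpperValue_of_forall_pos {Q : Set ((ι → R) × R)} {a : ι → R} {m : R}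
    (h : ∀ δ > 0, ∃ p, IsUpperValue Q p (m + δ ^ 2 / 2) ∧ ∀ i, |a i - p i| ≤ δ) :
    IsUpperValue Q a m := by
  intro q hq
  by_contra! hlt
  set K : R := ∑ i, |(q.1 + (2 : R) • a) i| with hK
  have hK0 : 0 ≤ K := Finset.sum_nonneg fun _ _ => abs_nonneg _
  set ε : R := q.1 ⬝ᵥ a + q.2 + a ⬝ᵥ a - m with hε
  have hε0 : 0 < ε := sub_pos.2 hlt
  -- The error at distance `δ ≤ 1` is at most `δ ^ 2 / 2 + δ * K ≤ δ * (1 + K) < ε`.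
  have hden : 0 < 1 + K + ε := by positivity
  obtain ⟨p, hp, hap⟩ := h (ε / (1 + K + ε)) (by positivity)
  set δ : R := ε / (1 + K + ε) with hδ
  have hδ0 : 0 < δ := by positivity
  have hδ1 : δ * (1 + K + ε) = ε := div_mul_cancel₀ _ hden.ne'
  have hδ2 : δ ≤ 1 := (div_le_one hden).2 (by linarith)
  have h1 : (q.1 + (2 : R) • a) ⬝ᵥ (a - p) ≤ δ * K := by
    rw [hK, Finset.mul_sum]
    refine Finset.sum_le_sum fun i _ => ?_
    calc (q.1 + (2 : R) • a) i * (a - p) i ≤ |(q.1 + (2 : R) • a) i * (a - p) i| := le_abs_self _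
      _ = |(a - p) i| * |(q.1 + (2 : R) • a) i| := by rw [abs_mul, mul_comm]
      _ ≤ δ * |(q.1 + (2 : R) • a) i| := mul_le_mul_of_nonneg_right (hap i) (abs_nonneg _)
  have h2 := hp q hq
  have h3 := zero_le_dotProduct_self (a - p)
  have h4 : p ⬝ᵥ a = a ⬝ᵥ p := dotProduct_comm _ _
  simp only [dotProduct_sub, sub_dotProduct, add_dotProduct, smul_dotProduct, smul_eq_mul, h4]
    at h1 h3
  have h5 : δ ^ 2 ≤ δ := by nlinarith
  nlinarith [mul_pos hδ0 hε0]

/-- Over a definably complete structure, a strongly convex function with definable epigraph that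
is bounded below attains its minimum. -/
theorem exists_isUpperValue_minimal {L : FirstOrder.Language} [L.Structure R]
    (hexp : IsOrderedFieldExpansion L R) (hdc : IsDefinablyComplete L R)
    {Q : Set ((ι → R) × R)}
    (hQ : (Set.univ : Set R).Definable L
      {v : ι ⊕ Unit → R | IsUpperValue Q (v ∘ Sum.inl) (v (Sum.inr ()))})
    (hne : ∃ p s, IsUpperValue Q p s) (hb : ∃ b, ∀ p s, IsUpperValue Q p s → b ≤ s) :
    ∃ a m, IsUpperValue Q a m ∧ ∀ p s, IsUpperValue Q p s → m ≤ s := by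
  obtain ⟨m, hm⟩ : ∃ m, IsGLB {s | ∃ p, IsUpperValue Q p s} m := by
    refine hdc.exists_isGLB hexp ?_ ?_ ?_
    · exact (hQ.preimage_comp (Sum.elim Sum.inr fun _ => Sum.inl (0 : Fin 1))).exists_of_finite
    · obtain ⟨p, s, h⟩ := hne
      exact ⟨s, p, h⟩
    · obtain ⟨b, hb⟩ := hb
      exact ⟨b, fun s ⟨p, h⟩ => hb p s h⟩
  have hmin : ∀ p s, IsUpperValue Q p s → m ≤ s := fun p s h => hm.1 ⟨p, h⟩
  have hclose : ∀ δ > 0, ∃ p, IsUpperValue Q p (m + δ ^ 2 / 2) := by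
    intro δ hδ
    obtain ⟨s, ⟨p, hp⟩, -, hs⟩ := hm.exists_between (lt_add_of_pos_right m (by positivity :
      0 < δ ^ 2 / 2))
    exact ⟨p, hp.mono hs.le⟩
  have hpair : ∀ i {p p' : ι → R} {δ δ' : R}, 0 ≤ δ → 0 ≤ δ' →
      IsUpperValue Q p (m + δ ^ 2 / 2) → IsUpperValue Q p' (m + δ' ^ 2 / 2) →
      p i - δ ≤ p' i + δ' := by
    intro i p p' δ δ' h0 h0' h h'
    have h1 : (p i - p' i) ^ 2 ≤ (δ + δ') ^ 2 := by
      have := sq_apply_le_dotProduct_self (p - p') i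
      rw [Pi.sub_apply] at this
      linarith [h.dotProduct_sub_self_le hmin h', mul_nonneg h0 h0']
    linarith [abs_le_of_sq_le_sq' h1 (add_nonneg h0 h0')]
  -- The intervals `[p i - δ, p i + δ]`, where `p` has the upper value `m + δ ^ 2 / 2`, intersect
  -- pairwise, so the supremum of their left end points lies in all of them.
  have hcoord : ∀ i, ∃ a, ∀ p δ, 0 ≤ δ → IsUpperValue Q p (m + δ ^ 2 / 2) → |a - p i| ≤ δ := by
    intro i
    obtain ⟨a, ha⟩ : ∃ a, IsLUB {t | ∃ p δ, 0 ≤ δ ∧ IsUpperValue Q p (m + δ ^ 2 / 2) ∧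
        t = p i - δ} a := by
      refine hdc _ ?_ ?_ ?_
      · have hvar : ∀ j, (Set.univ : Set R).DefinableFun L
            (fun v : Fin 1 ⊕ (ι ⊕ Unit) → R => v j) := fun j => Set.DefinableFun.proj L
        have hδ := hvar (.inr (.inr ()))
        have hmap : (Set.univ : Set R).DefinableMap L
            (fun (v : Fin 1 ⊕ (ι ⊕ Unit) → R) => Sum.elim (fun j => v (.inr (.inl j)))
              fun _ : Unit => m + v (.inr (.inr ())) * v (.inr (.inr ())) * (1 / 2)) := by
          rintro (j | j)
          · exact hvar _
          · exact hexp.definableFun_add (definableFun_const m)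
              (hexp.definableFun_mul (hexp.definableFun_mul hδ hδ) (definableFun_const (1 / 2)))
        have hset := ((hexp.definable_le (definableFun_const 0) hδ).inter
          ((hQ.preimage_map hmap).inter ((hvar (.inl 0)).ofPred_eq
            (hexp.definableFun_sub (hvar (.inr (.inl i))) hδ)))).exists_of_finite
        rw [Set.Definable₁]
        convert hset using 1
        ext x
        constructor
        · rintro ⟨p, δ, h0, h1, h2⟩
          refine ⟨Sum.elim p fun _ => δ, h0, ?_, h2⟩
          have : δ ^ 2 / 2 = δ * δ * (1 / 2) := by ring
          rwa [this] at h1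
        · rintro ⟨u, h0, h1, h2⟩
          refine ⟨fun j => u (.inl j), u (.inr ()), h0, ?_, h2⟩
          have : u (.inr ()) ^ 2 / 2 = u (.inr ()) * u (.inr ()) * (1 / 2) := by ring
          rw [this]
          exact h1
      · obtain ⟨p, hp⟩ := hclose 1 one_pos
        exact ⟨_, p, 1, zero_le_one, hp, rfl⟩
      · obtain ⟨p, hp⟩ := hclose 1 one_pos
        refine ⟨p i + 1, ?_⟩
        rintro _ ⟨p', δ', h0, h1, rfl⟩
        exact hpair i h0 zero_le_one h1 hp
    refine ⟨a, fun p δ h0 hp => abs_le.2 ⟨?_, ?_⟩⟩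
    · linarith [ha.1 ⟨p, δ, h0, hp, rfl⟩]
    · have : a ≤ p i + δ := ha.2 (by
        rintro _ ⟨p', δ', h0', h1, rfl⟩
        exact hpair i h0' h0 h1 hp)
      linarith
  choose a ha using hcoord
  refine ⟨a, m, isUpperValue_of_forall_pos fun δ hδ => ?_, hmin⟩
  obtain ⟨p, hp⟩ := hclose δ hδ
  exact ⟨p, hp, fun i => ha i p δ hδ.le hp⟩

end Minimization

namespace SetValuedMap

/-! ### Monotone maps and their resolvents -/

section Resolvent

variable {R : Type*} [Field R] [LinearOrder R] {n : ℕ}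

theorem mem_inverse_sum_identity {R : Type*} [Field R] {n : ℕ} {T : SetValuedMap R n n}
    {x w : Fin n → R} :
    w ∈ (T.sum identity).inverse x ↔ x - w ∈ T w := by
  simp only [inverse, sum, identity, Set.mem_ofPred_eq, Set.add_singleton, Set.image_add_right,
    Set.mem_preimage, sub_eq_add_neg]

variable [IsStrictOrderedRing R]

theorem isMonotone_iff_isFirmlyNonexpansiveMapOn (T : SetValuedMap R n n) :
    T.IsMonotone ↔ ∃ X, (T.sum identity).inverse.IsFirmlyNonexpansiveMapOn X := by
  constructor
  · intro hT
    have key : ∀ {x x' w w' : Fin n → R}, x - w ∈ T w → x' - w' ∈ T w' →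
        (w - w') ⬝ᵥ (w - w') ≤ (w - w') ⬝ᵥ (x - x') := by
      intro x x' w w' h h'
      have h1 := hT (w, x - w) h (w', x' - w') h'
      have h2 : (x - w) - (x' - w') = (x - x') - (w - w') := by abel
      simp only [h2] at h1
      rw [dotProduct_sub] at h1
      exact sub_nonneg.1 h1
    choose g hg using fun x : {x | ((T.sum identity).inverse x).Nonempty} => x.2
    refine ⟨_, g, fun x y => key (mem_inverse_sum_identity.1 (hg x))
      (mem_inverse_sum_identity.1 (hg y)), ?_⟩
    ext x w
    constructor
    · intro hw
      refine ⟨⟨w, hw⟩, ?_⟩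
      have := key (mem_inverse_sum_identity.1 hw) (mem_inverse_sum_identity.1 (hg ⟨x, ⟨w, hw⟩⟩))
      rw [sub_self x, dotProduct_zero] at this
      exact sub_eq_zero.1 (eq_zero_of_dotProduct_self_le_zero this)
    · rintro ⟨hx, rfl⟩
      exact hg ⟨x, hx⟩
  · rintro ⟨X, g, hg, hf⟩ ⟨w, u⟩ hp ⟨w', u'⟩ hq
    have hmem : ∀ {w u}, (w, u) ∈ T.graph → ∃ hx : u + w ∈ X, w = g ⟨u + w, hx⟩ := by
      intro w u h
      have h1 : w ∈ (T.sum identity).inverse (u + w) := by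
        rw [mem_inverse_sum_identity, add_sub_cancel_right]
        exact h
      rw [hf] at h1
      exact h1
    obtain ⟨hx, hw⟩ := hmem hp
    obtain ⟨hx', hw'⟩ := hmem hq
    have h1 := hg ⟨_, hx⟩ ⟨_, hx'⟩
    rw [← hw, ← hw'] at h1
    have h2 : u + w - (u' + w') = (u - u') + (w - w') := by abel
    simp only [h2] at h1
    rw [dotProduct_add] at h1
    exact nonneg_of_le_add_left h1

theorem isMaximalMonotone_of_isFirmlyNonexpansiveMapOn_univ {T : SetValuedMap R n n}
    (hT : (T.sum identity).inverse.IsFirmlyNonexpansiveMapOn Set.univ) :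
    T.IsMaximalMonotone := by
  refine ⟨T.isMonotone_iff_isFirmlyNonexpansiveMapOn.2 ⟨_, hT⟩, ?_⟩
  rintro ⟨x, u⟩ hp hrel
  obtain ⟨g, -, hf⟩ := hT
  -- The point `w = f (x + u)` of the resolvent satisfies `x + u - w ∈ T w`.
  have hw : x + u - g ⟨x + u, trivial⟩ ∈ T (g ⟨x + u, trivial⟩) := by
    rw [← mem_inverse_sum_identity, hf]
    exact ⟨trivial, rfl⟩
  set w := g ⟨x + u, trivial⟩
  have h1 := hrel (w, x + u - w) hw
  have h2 : u - (x + u - w) = -(x - w) := by abel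
  simp only [h2] at h1
  rw [dotProduct_neg, neg_nonneg] at h1
  have h3 : x = w := sub_eq_zero.1 (eq_zero_of_dotProduct_self_le_zero h1)
  rw [← h3, add_sub_cancel_left] at hw
  exact hp hw

end Resolvent

/-! ### The Fitzpatrick function -/

section Fitzpatrick

variable {R : Type*} [Field R] [LinearOrder R] {n : ℕ}

/-- The affine functions `p ↦ 2 * (⟨p₁, y*⟩ + ⟨y, p₂⟩ - ⟨y, y*⟩)` for `(y, y*)` in the graph of
`T`, encoded by their linear part and their constant term. Their supremum is twice the Fitzpatrick
function of `T`. -/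
def fitzpatrick (T : SetValuedMap R n n) : Set ((Fin n ⊕ Fin n → R) × R) :=
  {q | ∃ y u, u ∈ T y ∧ q = ((2 : R) • Sum.elim u y, -(2 * (y ⬝ᵥ u)))}

theorem isUpperValue_fitzpatrick_iff {T : SetValuedMap R n n} {p : Fin n ⊕ Fin n → R} {s : R} :
    IsUpperValue T.fitzpatrick p s ↔ ∀ y u, u ∈ T y →
      2 * ((p ∘ Sum.inl) ⬝ᵥ u + y ⬝ᵥ (p ∘ Sum.inr) - y ⬝ᵥ u) + p ⬝ᵥ p ≤ s := by
  have key : ∀ y u : Fin n → R,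
      ((2 : R) • Sum.elim u y) ⬝ᵥ p + -(2 * (y ⬝ᵥ u)) + p ⬝ᵥ p =
        2 * ((p ∘ Sum.inl) ⬝ᵥ u + y ⬝ᵥ (p ∘ Sum.inr) - y ⬝ᵥ u) + p ⬝ᵥ p := by
    intro y u
    have : Sum.elim u y ⬝ᵥ p = u ⬝ᵥ (p ∘ Sum.inl) + y ⬝ᵥ (p ∘ Sum.inr) := by
      simp [dotProduct]
    rw [smul_dotProduct, this, smul_eq_mul, dotProduct_comm u]
    ring
  constructor
  · intro h y u hu
    rw [← key]
    exact h _ ⟨y, u, hu, rfl⟩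
  · rintro h _ ⟨y, u, hu, rfl⟩
    rw [key]
    exact h y u hu

theorem IsDefinable.isUpperValue_fitzpatrick {L : FirstOrder.Language} [L.Structure R]
    (hexp : IsOrderedFieldExpansion L R) {T : SetValuedMap R n n} (hT : T.IsDefinable L) :
    (Set.univ : Set R).Definable L {v : (Fin n ⊕ Fin n) ⊕ Unit → R |
      IsUpperValue T.fitzpatrick (v ∘ Sum.inl) (v (Sum.inr ()))} := by
  -- The coordinates are a point `p` (`inl (inl _)`), a value `s` (`inl (inr ())`) and a pair
  -- `(y, u)` (`inr _`), over which the epigraph condition quantifies.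
  have hproj : ∀ {β : Type} (e : β → ((Fin n ⊕ Fin n) ⊕ Unit) ⊕ (Fin n ⊕ Fin n)),
      (Set.univ : Set R).DefinableMap L fun v => v ∘ e := fun e i => Set.DefinableFun.proj L
  have hd := fun {β : Type} [Fintype β] (e e' : β → ((Fin n ⊕ Fin n) ⊕ Unit) ⊕ (Fin n ⊕ Fin n)) =>
    hexp.definableFun_dotProduct (hproj e) (hproj e')
  have hle := hexp.definable_le
    (hexp.definableFun_add (hexp.definableFun_mul (definableFun_const 2)
      (hexp.definableFun_sub (hexp.definableFun_add
          (hd (fun i => .inl (.inl (.inl i))) fun i => .inr (.inr i))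
          (hd (fun i => .inr (.inl i)) fun i => .inl (.inl (.inr i))))
        (hd (fun i => .inr (.inl i)) fun i => .inr (.inr i))))
      (hd (fun i => .inl (.inl i)) fun i => .inl (.inl i)))
    (Set.DefinableFun.proj L (i := .inl (.inr ())))
  convert ((hT.preimage_comp Sum.inr).himp hle).forall_of_finite using 1
  ext v
  simp only [Set.mem_ofPred_eq, isUpperValue_fitzpatrick_iff]
  constructor
  · intro h u hu
    exact h _ _ hu
  · intro h y u hu
    exact h (Sum.elim y u) hu

theorem dotProduct_eq_inl_add_inr {R : Type*} [Field R] {n : ℕ} (p q : Fin n ⊕ Fin n → R) :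
    p ⬝ᵥ q = (p ∘ Sum.inl) ⬝ᵥ (q ∘ Sum.inl) + (p ∘ Sum.inr) ⬝ᵥ (q ∘ Sum.inr) := by
  simp [dotProduct]

variable [IsStrictOrderedRing R]

theorem IsMonotone.isUpperValue {T : SetValuedMap R n n} (hT : T.IsMonotone)
    {y u : Fin n → R} (hu : u ∈ T y) :
    IsUpperValue T.fitzpatrick (Sum.elim y u)
      (2 * (y ⬝ᵥ u) + Sum.elim y u ⬝ᵥ Sum.elim y u) := by
  rw [isUpperValue_fitzpatrick_iff]
  intro y' u' hu'
  have h := hT (y, u) hu (y', u') hu'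
  simp only [dotProduct_sub, sub_dotProduct] at h
  simp only [Sum.elim_comp_inl, Sum.elim_comp_inr]
  linarith

/-- First-order optimality at a minimizer `a` with value `m`, tested against a point `(y, u)` of
the graph of `T`: the function lies above its tangent at `a`, and its value at `(y, u)` is
`2 * ⟨y, u⟩ + ⟨(y, u), (y, u)⟩`. -/
theorem IsMonotone.le_of_minimal {T : SetValuedMap R n n} (hT : T.IsMonotone)
    {a : Fin n ⊕ Fin n → R} {m : R} (ha : IsUpperValue T.fitzpatrick a m)
    (hmin : ∀ p s, IsUpperValue T.fitzpatrick p s → m ≤ s) {y u : Fin n → R} (hu : u ∈ T y) :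
    m + a ⬝ᵥ a ≤ 2 * (y ⬝ᵥ u + (a ∘ Sum.inl) ⬝ᵥ y + (a ∘ Sum.inr) ⬝ᵥ u) := by
  have hp := hT.isUpperValue hu
  have hap : a ⬝ᵥ Sum.elim y u = (a ∘ Sum.inl) ⬝ᵥ y + (a ∘ Sum.inr) ⬝ᵥ u := by
    rw [dotProduct_eq_inl_add_inr, Sum.elim_comp_inl, Sum.elim_comp_inr]
  set p : Fin n ⊕ Fin n → R := Sum.elim y u
  set D : R := (a - p) ⬝ᵥ (a - p) with hD
  have hD0 : 0 ≤ D := zero_le_dotProduct_self _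
  have hpa : p ⬝ᵥ a = a ⬝ᵥ p := dotProduct_comm _ _
  have hD' : D = a ⬝ᵥ a - 2 * (a ⬝ᵥ p) + p ⬝ᵥ p := by
    simp only [hD, dotProduct_sub, sub_dotProduct, hpa]
    ring
  by_contra! hlt
  set e : R := m - (2 * (y ⬝ᵥ u) + p ⬝ᵥ p) + D with he
  have he0 : 0 < e := by linarith
  -- Minimality along the segment from `a` to `p` gives `e ≤ t * D` for `0 < t ≤ 1`, which fails
  -- for `t = e / (e + D)`.
  have heD : 0 < e + D := by positivity
  set t : R := e / (e + D) with ht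
  have ht0 : 0 < t := by positivity
  have ht1 : t ≤ 1 := (div_le_one heD).2 (by linarith)
  have htD : t * (e + D) = e := div_mul_cancel₀ _ heD.ne'
  have h1 := hmin _ _ (ha.segment hp ht0.le ht1)
  have h2 : t * e ≤ t * (t * D) := by
    rw [he]
    linarith
  have h3 := le_of_mul_le_mul_left h2 ht0
  linarith [mul_pos ht0 he0]

/-- The Fitzpatrick function of a maximal monotone map is bounded below by `(x, u) ↦ ⟨x, u⟩`: a
point `p` at which it were smaller would be monotonically related to `T`, hence in its graph, where
the two functions agree. -/
theorem IsMaximalMonotone.le_of_isUpperValue {T : SetValuedMap R n n} (hT : T.IsMaximalMonotone)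
    {p : Fin n ⊕ Fin n → R} {s : R} (h : IsUpperValue T.fitzpatrick p s) :
    2 * ((p ∘ Sum.inl) ⬝ᵥ (p ∘ Sum.inr)) + p ⬝ᵥ p ≤ s := by
  rw [isUpperValue_fitzpatrick_iff] at h
  by_contra! hlt
  have hmem : (p ∘ Sum.inl, p ∘ Sum.inr) ∈ T.graph := by
    by_contra hp
    refine hT.2 _ hp fun q hq => ?_
    have := h q.1 q.2 hq
    simp only [dotProduct_sub, sub_dotProduct]
    linarith
  have := h _ _ hmem
  linarith

end Fitzpatrick

/-! ### Surjectivity of `T + id` -/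

section Surjectivity

variable {R : Type*} [Field R] [LinearOrder R] {n : ℕ}

/-- The translate `x ↦ T x - z`. -/
def translate (T : SetValuedMap R n n) (z : Fin n → R) : SetValuedMap R n n :=
  fun x => {u | u + z ∈ T x}

theorem IsDefinable.translate {L : FirstOrder.Language} [L.Structure R]
    (hexp : IsOrderedFieldExpansion L R) {T : SetValuedMap R n n} (hT : T.IsDefinable L)
    (z : Fin n → R) : (T.translate z).IsDefinable L := by
  have hF : (Set.univ : Set R).DefinableMap L (fun v : Fin n ⊕ Fin n → R =>
      Sum.elim (fun i => v (.inl i)) fun i => v (.inr i) + z i) := by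
    rintro (i | i)
    · exact Set.DefinableFun.proj L
    · exact hexp.definableFun_add (Set.DefinableFun.proj L) (definableFun_const (z i))
  exact hT.preimage_map hF

theorem monotonicallyRelated_translate_iff {T : SetValuedMap R n n} {z x u : Fin n → R} :
    (T.translate z).MonotonicallyRelated (x, u) ↔ T.MonotonicallyRelated (x, u + z) := by
  constructor
  · intro h q hq
    have h1 := h (q.1, q.2 - z) (by simpa [translate, graph] using hq)
    have h2 : u + z - q.2 = u - (q.2 - z) := by abel
    simpa only [h2] using h1
  · intro h q hq
    have h1 := h (q.1, q.2 + z) hq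
    simpa only [add_sub_add_right_eq_sub] using h1

theorem IsMaximalMonotone.translate {T : SetValuedMap R n n} (hT : T.IsMaximalMonotone)
    (z : Fin n → R) : (T.translate z).IsMaximalMonotone :=
  ⟨fun p hp => monotonicallyRelated_translate_iff.2 (hT.1 (p.1, p.2 + z) hp),
    fun p hp h => hT.2 (p.1, p.2 + z) hp (monotonicallyRelated_translate_iff.1 h)⟩

variable [IsStrictOrderedRing R]

/-- The case `z = 0` of the surjectivity of `T + id`. At the minimizer `a = (a₁, a₂)`, optimality
and the lower bound on the Fitzpatrick function show that `(-a₂, -a₁)` is monotonically related to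
`T`, with a margin `⟨a₁ + a₂, a₁ + a₂⟩`. By maximality it is in the graph, so the margin is `0`. -/
theorem IsMaximalMonotone.exists_neg_mem {L : FirstOrder.Language} [L.Structure R]
    (hexp : IsOrderedFieldExpansion L R) (hdc : IsDefinablyComplete L R)
    {T : SetValuedMap R n n} (hdef : T.IsDefinable L) (hT : T.IsMaximalMonotone) :
    ∃ w, -w ∈ T w := by
  have hsq : ∀ p : Fin n ⊕ Fin n → R, (p ∘ Sum.inl + p ∘ Sum.inr) ⬝ᵥ (p ∘ Sum.inl + p ∘ Sum.inr) =
      2 * ((p ∘ Sum.inl) ⬝ᵥ (p ∘ Sum.inr)) + p ⬝ᵥ p := by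
    intro p
    rw [dotProduct_eq_inl_add_inr p p]
    simp only [dotProduct_add, add_dotProduct]
    rw [dotProduct_comm (p ∘ Sum.inr) (p ∘ Sum.inl)]
    ring
  obtain ⟨⟨y, u⟩, hyu⟩ : T.graph.Nonempty := by
    by_contra! hempty
    refine hT.2 (0, 0) (by simp [hempty]) fun q hq => ?_
    simp [hempty] at hq
  obtain ⟨a, m, ha, hmin⟩ := exists_isUpperValue_minimal hexp hdc
    (hdef.isUpperValue_fitzpatrick hexp) ⟨_, _, hT.1.isUpperValue hyu⟩
    ⟨0, fun p s h => (zero_le_dotProduct_self _).trans ((hsq p).trans_le (hT.le_of_isUpperValue h))⟩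
  have hm := hT.le_of_isUpperValue ha
  have hsqa := hsq a
  set a₁ := a ∘ Sum.inl
  set a₂ := a ∘ Sum.inr
  have hrel : ∀ q ∈ T.graph, (a₁ + a₂) ⬝ᵥ (a₁ + a₂) ≤ (-a₂ - q.1) ⬝ᵥ (-a₁ - q.2) := by
    intro q hq
    have h1 : m + a ⬝ᵥ a ≤ 2 * (q.1 ⬝ᵥ q.2 + a₁ ⬝ᵥ q.1 + a₂ ⬝ᵥ q.2) :=
      hT.1.le_of_minimal ha hmin hq
    have h2 : (-a₂ - q.1) ⬝ᵥ (-a₁ - q.2) =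
        a₁ ⬝ᵥ a₂ + (q.1 ⬝ᵥ q.2 + a₁ ⬝ᵥ q.1 + a₂ ⬝ᵥ q.2) := by
      simp only [dotProduct_sub, sub_dotProduct, neg_dotProduct, dotProduct_neg]
      rw [dotProduct_comm a₂ a₁, dotProduct_comm q.1 a₁]
      ring
    linarith
  have hmem : (-a₂, -a₁) ∈ T.graph := by
    by_contra hp
    exact hT.2 _ hp fun q hq => (zero_le_dotProduct_self _).trans (hrel q hq)
  have h0 := hrel _ hmem
  rw [sub_self, zero_dotProduct] at h0
  have ha₁ : - -a₂ = -a₁ := by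
    rw [neg_neg, neg_eq_of_add_eq_zero_right (eq_zero_of_dotProduct_self_le_zero h0)]
  exact ⟨-a₂, ha₁ ▸ hmem⟩

theorem IsMaximalMonotone.isFirmlyNonexpansiveMapOn_univ {L : FirstOrder.Language} [L.Structure R]
    (hexp : IsOrderedFieldExpansion L R) (hdc : IsDefinablyComplete L R)
    {T : SetValuedMap R n n} (hdef : T.IsDefinable L) (hT : T.IsMaximalMonotone) :
    (T.sum identity).inverse.IsFirmlyNonexpansiveMapOn Set.univ := by
  obtain ⟨X, hX⟩ := T.isMonotone_iff_isFirmlyNonexpansiveMapOn.1 hT.1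
  suffices X = Set.univ by rwa [this] at hX
  refine Set.eq_univ_of_forall fun z => ?_
  obtain ⟨w, hw⟩ := (hT.translate z).exists_neg_mem hexp hdc (hdef.translate hexp z)
  have hmem : w ∈ (T.sum identity).inverse z := by
    rw [mem_inverse_sum_identity, sub_eq_neg_add]
    exact hw
  obtain ⟨g, -, hg⟩ := hX
  rw [hg] at hmem
  exact hmem.1

end Surjectivity

end SetValuedMap

end DefinableMonotone

theorem mainTheorem6 {R : Type*} [Field R] [LinearOrder R] [IsStrictOrderedRing R]
    (L : FirstOrder.Language) [L.Structure R]
    (hexp : DefinableMonotone.IsOrderedFieldExpansion L R)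
    (hdc : DefinableMonotone.IsDefinablyComplete L R)
    (n : ℕ) (T f : DefinableMonotone.SetValuedMap R n n)
    (hf : f = (T.sum DefinableMonotone.SetValuedMap.identity).inverse) :
    (T.IsMonotone ↔ ∃ X : Set (Fin n → R), f.IsFirmlyNonexpansiveMapOn X) ∧
    (f.IsFirmlyNonexpansiveMapOn Set.univ → T.IsMaximalMonotone) ∧
    (T.IsDefinable L → T.IsMaximalMonotone → f.IsFirmlyNonexpansiveMapOn Set.univ) := by
  subst hf
  exact ⟨T.isMonotone_iff_isFirmlyNonexpansiveMapOn,
    DefinableMonotone.SetValuedMap.isMaximalMonotone_of_isFirmlyNonexpansiveMapOn_univ,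
    fun hdef hT => hT.isFirmlyNonexpansiveMapOn_univ hexp hdc hdef⟩
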